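/- **Theorem.** Let $N$ be a finite set with $n$ elements, let $k\in\mathbb N$, and let $L=\{0,\dots,k\}^N$. Let $v:L\to\mathbb R$ be a $k$-ary capacity, that is, $v(0,\dots,0)=0$, $v(k,\dots,k)=1$ and $v(x)\le v(y)$ whenever $x\le y$. For $z\in[0,k]^N$ with integer part $q=\lfloor z\rfloor$ let $$\mathcal C_v(z)=v(q)+C_{\mu_q}(z-q),\qquad \mu_q(A)=v\big((q+1)_A,q_{-A}\big)-v(q)\quad(A\subseteq N),$$ where $C_\mu(w)=\int_0^\infty \mu(\{i: w_i\ge t\})\,dt$ is the Choquet integral (a coordinate of $q$ equal to $k$ is not increased in $\mu_q$; this does not affect the value). For $T\subseteq N$ with $|T|=t$ let $$I^v_{\mathrm s}(T)=\sum_{x_{-T}\in\{0,\dots,k\}^{N\setminus T}}\frac{(n-s(x_{-T})-t)!\,k(x_{-T})!}{(n-s(x_{-T})+k(x_{-T})-t+1)!}\sum_{A\subseteq T}(-1)^{t-|A|}\,v(0_{T\setminus A},k_A,x_{-T}),$$ where $s(x_{-T})$ and $k(x_{-T})$ are the numbers of coordinates of $x_{-T}$ that are $\neq 0$ and $=k$,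 respectively. Then $\mathcal C_v$ is integrable on $[0,k]^N$ and, for every $T\subseteq N$, $$I^v_{\mathrm s}(T)=\int_{[0,k]^n}\frac{\partial^{|T|}\mathcal C_v}{\partial z_T}(z)\,dz ,$$ where $\partial^{|T|}/\partial z_T$ is one partial derivative with respect to each $z_i$, $i\in T$, taken in the sense of distributions in the interior of the box: the distribution $\partial^{|T|}\mathcal C_v/\partial z_T$ on $(0,k)^N$ is given by a finite signed measure, and every such measure has total mass $I^v_{\mathrm s}(T)$ on $(0,k)^N$. Moreover, when $T=\{i\}$, the ordinary partial derivative $\partial\mathcal C_v/\partial z_i$ exists almost everywhere on $[0,k]^N$, is integrable, and the formula holds with it as a Lebesgue integral. -/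

import Mathlib

open MeasureTheory TopologicalSpace
open scoped Distributions LineDeriv Nat

noncomputable section

namespace KAry

/-- A `k`-ary capacity on the attribute set `N`: a function on `L = {0, …, k}^N` that vanishes at
`(0, …, 0)`, is monotone, and takes the value `1` at `(k, …, k)`. -/
structure IsCapacity {N : Type*} {k : ℕ} (v : (N → Fin (k + 1)) → ℝ) : Prop where
  zero : v (fun _ => 0) = 0
  mono : Monotone v
  top : v (fun _ => Fin.last k) = 1

section Index

variable {N : Type*} [Fintype N] [DecidableEq N] {k : ℕ}

/-- The point `(0_{T \ A}, k_A, x_{-T})` of `L`. -/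
def compound (T A : Finset N) (x : {i : N // i ∉ T} → Fin (k + 1)) : N → Fin (k + 1) :=
  fun i => if h : i ∈ T then (if i ∈ A then Fin.last k else 0) else x ⟨i, h⟩

/-- `s(x_{-T})`: the number of coordinates of `x_{-T}` that are different from `0`. -/
def suppCard (T : Finset N) (x : {i : N // i ∉ T} → Fin (k + 1)) : ℕ :=
  (Finset.univ.filter fun i => x i ≠ 0).card

/-- `k(x_{-T})`: the number of coordinates of `x_{-T}` that are equal to `k`. -/
def kerCard (T : Finset N) (x : {i : N // i ∉ T} → Fin (k + 1)) : ℕ :=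
  (Finset.univ.filter fun i => x i = Fin.last k).card

/-- The interaction index `I_s^v(T)`. As `s(x_{-T}) ≤ n - t`, no subtraction is truncated. -/
def interaction (v : (N → Fin (k + 1)) → ℝ) (T : Finset N) : ℝ :=
  ∑ x : {i : N // i ∉ T} → Fin (k + 1),
    (((Fintype.card N - suppCard T x - T.card)! * (kerCard T x)! : ℕ) : ℝ) /
        (((Fintype.card N - suppCard T x + kerCard T x - T.card + 1)! : ℕ) : ℝ) *
      ∑ A ∈ T.powerset, (-1 : ℝ) ^ (T.card - A.card) * v (compound T A x)

/-- The Choquet integral `∫_0^∞ μ({i | w_i ≥ t}) dt` of a nonnegative vector `w` with respect to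
a set function `μ` with `μ(∅) = 0`. -/
def choquetIntegral (μ : Finset N → ℝ) (w : N → ℝ) : ℝ :=
  ∫ t in Set.Ioi (0 : ℝ), μ (Finset.univ.filter fun i => t ≤ w i)

end Index

section Choquet

variable {N : Type*} {k : ℕ}

/-- The element `min m k` of `{0, …, k}`. -/
def level (k m : ℕ) : Fin (k + 1) := ⟨min m k, by omega⟩

/-- The integer part `⌊z⌋ ∈ L` of a point `z ∈ [0,k]^N`. -/
def gridFloor (k : ℕ) (z : N → ℝ) : N → Fin (k + 1) := fun i => level k ⌊z i⌋₊

/-- `μ_q(A) = v((q+1)_A, q_{-A}) - v(q)`. A coordinate that is already equal to `k` is left at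
`k`; for `q = ⌊z⌋` such a coordinate has `z_i - q_i = 0`, so that this convention has no influence
on the Choquet integral of `z - q`. -/
def cellGame [DecidableEq N] (v : (N → Fin (k + 1)) → ℝ) (q : N → Fin (k + 1))
    (A : Finset N) : ℝ :=
  v (fun i => if i ∈ A then level k ((q i : ℕ) + 1) else q i) - v q

/-- The Choquet integral `C_v(z) = v(q) + C_{μ_q}(z - q)`, `q = ⌊z⌋`, with respect to `v`. It is
meaningful for `z ∈ [0,k]^N` only. -/
def choquetExt [Fintype N] [DecidableEq N] (v : (N → Fin (k + 1)) → ℝ) (z : N → ℝ) : ℝ :=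
  v (gridFloor k z) +
    choquetIntegral (cellGame v (gridFloor k z)) (fun i => z i - ((gridFloor k z i : ℕ) : ℝ))

end Choquet

section Distributions

variable {N : Type*} [Fintype N]

/-- The closed box `[0,k]^N`. -/
def closedBox (N : Type*) (k : ℕ) : Set (N → ℝ) := Set.univ.pi fun _ => Set.Icc (0 : ℝ) k

/-- The open box `(0,k)^N`. -/
def openBox (N : Type*) [Fintype N] (k : ℕ) : Opens (N → ℝ) :=
  ⟨Set.univ.pi fun _ => Set.Ioo (0 : ℝ) k,
    isOpen_set_pi Set.finite_univ fun _ _ => isOpen_Ioo⟩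

/-- The distribution `g ↦ ∫ g(z) f(z) dz` on `Ω` defined by a locally integrable function `f`. -/
def toDistribution (Ω : Opens (N → ℝ)) (f : (N → ℝ) → ℝ) : 𝓓'(Ω, ℝ) :=
  TestFunction.integralAgainstBilinCLM (ContinuousLinearMap.mul ℝ ℝ) volume f

/-- The mixed partial derivative `∂^{|T|} u / ∂z_T` (one derivative with respect to each
coordinate in `T`) of a distribution `u`. The order of differentiation is immaterial. -/
def mixedPartial [DecidableEq N] {Ω : Opens (N → ℝ)} (T : Finset N) (u : 𝓓'(Ω, ℝ)) : 𝓓'(Ω, ℝ) :=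
  ∂^{fun j : Fin T.card => (Pi.single (T.equivFin.symm j : N) (1 : ℝ) : N → ℝ)} u

/-- The distribution `u` on `Ω` is the finite signed measure `D`: `u(g) = ∫ g dD` for every test
function `g` on `Ω`. -/
def IsRepresentedBy {Ω : Opens (N → ℝ)} (u : 𝓓'(Ω, ℝ)) (D : SignedMeasure (N → ℝ)) : Prop :=
  ∀ g : 𝓓(Ω, ℝ), u g = ∫ᵛ z, g z ∂<•D

/-- The ordinary (pointwise) partial derivative `∂f/∂z_i (z)`. -/
def partialDeriv [DecidableEq N] (i : N) (f : (N → ℝ) → ℝ) (z : N → ℝ) : ℝ :=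
  deriv (fun s => f (Function.update z i s)) (z i)

end Distributions

end KAry

end

noncomputable section

namespace KAry

set_option linter.unusedSectionVars false

/-! ### Face measures and their distributional derivatives -/

section FaceMeasure

variable {N : Type*} [Fintype N] [DecidableEq N]

/-! On the open box, `C_v(z) = ∫_0^1 v(p_t(z)) dt`, where `p_t(z) ∈ L` has coordinate `q_i + 1` if
`t ≤ z_i - q_i` and `q_i` otherwise. Equivalently, `p_t(z) = x` iff `x_i - 1 + t ≤ z_i < x_i + t`
for all `i`. The indicator of this cell is a product of differences of half-line indicators;
expanding it writes `C_v` as a signed combination of functions `stepMean c`, averages over `t` of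
indicators of orthants with corner `c + t` (`choquetExt_eq`).

Differentiating an orthant indicator once in each direction of `T` puts a point mass at `c_i + t`
for `i ∈ T` and leaves Lebesgue measure on the half-lines in the other directions. Averaged over
`t`, this is `faceMeasure` (`integral_lineDeriv_faceMeasure`), so the mixed derivative is a finite
signed measure.

For fixed `t` its mass on the box is a product over coordinates, and the signed sum over corners
refactors into one product per `x`. A coordinate in `T` contributes `1` if `x_i = k`, `-1` if `x_i =
0` and `0` otherwise; one outside `T` contributes `t` if `x_i = 0`, `1 - t` if `x_i = k` and `1`
otherwise. Integration over `t` is a beta integral, which gives the factorial weights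
(`sum_faceMeasure_openBox`).

Cutoffs increasing to the box in the pointwise limit transfer this value to any representing
measure. For `T = {i}` the averages are Lipschitz, so Rademacher's theorem along lines and
integration by parts yield the pointwise statement. -/

theorem measurePreserving_update_pi (μ : N → Measure ℝ) [∀ i, SigmaFinite (μ i)] (j : N)
    (ν : Measure ℝ) [IsProbabilityMeasure ν] :
    MeasurePreserving (fun p : ℝ × (N → ℝ) => Function.update p.2 j p.1)
      ((μ j).prod (Measure.pi (fun i => if i = j then ν else μ i))) (Measure.pi μ) := by
  have hm : Measurable (fun p : ℝ × (N → ℝ) => Function.update p.2 j p.1) := by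
    refine measurable_pi_iff.2 fun i => ?_
    by_cases h : i = j
    · subst h; simpa using measurable_fst
    · simp only [Function.update_of_ne h]; fun_prop
  have hσ : ∀ i, SigmaFinite (if i = j then ν else μ i) := fun i => by
    split_ifs <;> infer_instance
  refine ⟨hm, (Measure.pi_eq fun s hs => ?_).symm⟩
  rw [Measure.map_apply hm (MeasurableSet.univ_pi hs)]
  -- The old coordinate `j` is overwritten, so `ν` enters only through its total mass `1`.
  have : (fun p : ℝ × (N → ℝ) => Function.update p.2 j p.1) ⁻¹' (Set.univ.pi s) =
      (s j) ×ˢ (Set.univ.pi fun i => if i = j then Set.univ else s i) := by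
    ext p
    simp only [Set.mem_preimage, Set.mem_pi, Set.mem_univ, true_implies, Set.mem_prod]
    constructor
    · intro h
      refine ⟨by simpa using h j, fun i => ?_⟩
      by_cases hi : i = j
      · simp [hi]
      · simpa [hi] using h i
    · rintro ⟨h1, h2⟩ i
      by_cases hi : i = j
      · subst hi; simpa using h1
      · simpa [hi] using h2 i
  rw [this, Measure.prod_prod, Measure.pi_pi,
    ← Finset.mul_prod_erase Finset.univ _ (Finset.mem_univ j),
    ← Finset.mul_prod_erase Finset.univ (fun i => μ i (s i)) (Finset.mem_univ j)]
  simp only [if_true, measure_univ, one_mul]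
  congr 1
  refine Finset.prod_congr rfl fun i hi => ?_
  simp [Finset.ne_of_mem_erase hi]

/-- The coordinate measures of `faceMeasure`: a point mass in the directions of `T`, Lebesgue
measure on `(0, k)` in the others. -/
def faceBase (k : ℕ) (T : Finset N) (i : N) : Measure ℝ :=
  if i ∈ T then Measure.dirac 0 else volume.restrict (Set.Ioo (0 : ℝ) k)

instance (k : ℕ) (T : Finset N) (i : N) : IsFiniteMeasure (faceBase k T i) := by
  unfold faceBase; split_ifs <;> infer_instance

/-- The point with coordinates `c i + t` for `i ∈ T` and `z i` for `i ∉ T`. -/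
def facePoint (T : Finset N) (c : N → ℝ) (t : ℝ) (z : N → ℝ) : N → ℝ :=
  fun i => if i ∈ T then c i + t else z i

/-- The pairs `(t, z)` with `c i + t ≤ z i` for all `i ∉ T`. -/
def faceRegion (T : Finset N) (c : N → ℝ) : Set (ℝ × (N → ℝ)) :=
  {p | ∀ i, i ∉ T → c i + p.1 ≤ p.2 i}

theorem measurableSet_faceRegion (T : Finset N) (c : N → ℝ) :
    MeasurableSet (faceRegion T c) := by
  have : faceRegion T c = ⋂ i, ⋂ (_ : i ∉ T), {p : ℝ × (N → ℝ) | c i + p.1 ≤ p.2 i} := by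
    ext; simp [faceRegion]
  rw [this]
  refine MeasurableSet.iInter fun i => MeasurableSet.iInter fun _ => ?_
  exact measurableSet_le (by fun_prop) (by fun_prop)

theorem measurable_facePoint (T : Finset N) (c : N → ℝ) :
    Measurable (fun p : ℝ × (N → ℝ) => facePoint T c p.1 p.2) := by
  refine measurable_pi_iff.2 fun i => ?_
  unfold facePoint
  split_ifs <;> fun_prop

/-- For `c : N → ℝ`, the measure `∂^{|T|} / ∂z_T` of the function
`z ↦ |{t ∈ (0,1) : c i + t ≤ z i for all i}|` on the box `(0,k)^N`. -/
def faceMeasure (k : ℕ) (T : Finset N) (c : N → ℝ) : Measure (N → ℝ) :=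
  Measure.map (fun p : ℝ × (N → ℝ) => facePoint T c p.1 p.2)
    (((volume.restrict (Set.Ioo (0 : ℝ) 1)).prod (Measure.pi (faceBase k T))).restrict
      (faceRegion T c))

instance (k : ℕ) (T : Finset N) (c : N → ℝ) : IsFiniteMeasure (faceMeasure k T c) := by
  unfold faceMeasure; infer_instance

theorem integral_faceMeasure (k : ℕ) (T : Finset N) (c : N → ℝ) {h : (N → ℝ) → ℝ}
    (hm : Measurable h) {C : ℝ} (hC : ∀ z, ‖h z‖ ≤ C) :
    ∫ z, h z ∂(faceMeasure k T c) = ∫ t in Set.Ioo (0 : ℝ) 1, ∫ z,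
      (faceRegion T c).indicator (fun p => h (facePoint T c p.1 p.2)) (t, z)
        ∂(Measure.pi (faceBase k T)) := by
  rw [faceMeasure, integral_map (measurable_facePoint T c).aemeasurable
    hm.aestronglyMeasurable, ← integral_indicator (measurableSet_faceRegion T c), integral_prod]
  have hm' : Measurable ((faceRegion T c).indicator
      (fun p : ℝ × (N → ℝ) => h (facePoint T c p.1 p.2))) :=
    (hm.comp (measurable_facePoint T c)).indicator (measurableSet_faceRegion T c)
  refine Integrable.of_bound hm'.aestronglyMeasurable C (.of_forall fun p => ?_)
  exact (norm_indicator_le_norm_self _ _).trans (hC _)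

/-- Coordinates in `T` are dummies, since `facePoint` overwrites them; their base measure only has
to have mass `1`. Hence `measurePreserving_update_pi` with `ν = dirac 0` applies when a direction is
added to `T`. -/
theorem faceBase_insert (k : ℕ) (T : Finset N) (j : N) :
    faceBase k (insert j T) =
      fun i => if i = j then Measure.dirac 0 else faceBase k T i := by
  funext i
  by_cases h : i = j <;> simp [faceBase, h]

theorem eq_zero_of_notMem_openBox {k : ℕ} (g : 𝓓(openBox N k, ℝ)) {z : N → ℝ}
    (hz : z ∉ openBox N k) : g z = 0 :=
  image_eq_zero_of_notMem_tsupport fun h => hz (g.tsupport_subset h)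

theorem mem_openBox {k : ℕ} {z : N → ℝ} : z ∈ openBox N k ↔ ∀ i, z i ∈ Set.Ioo (0 : ℝ) k := by
  change z ∈ Set.univ.pi _ ↔ _
  simp [Set.mem_pi]

theorem exists_norm_le {k : ℕ} (g : 𝓓(openBox N k, ℝ)) : ∃ C, ∀ z, ‖g z‖ ≤ C :=
  g.continuous.bounded_above_of_compact_support g.hasCompactSupport

theorem lineDerivOp_apply_eq {k : ℕ} (g : 𝓓(openBox N k, ℝ)) (w z : N → ℝ) :
    (∂_{w} g : 𝓓(openBox N k, ℝ)) z = lineDeriv ℝ g z w :=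
  TestFunction.lineDerivCLM_apply_of_le (𝕜 := ℝ) (k := ⊤) (n := ⊤) (by simp)

/-- The fundamental theorem of calculus on `[a, ∞)`, with no boundary term at infinity. As `g` and
its derivative vanish off the box, integrating over `(0, k)` loses nothing and `a`, `w` can be
arbitrary. -/
theorem integral_Ioo_lineDeriv_update {k : ℕ} (g : 𝓓(openBox N k, ℝ)) (j : N) (w : N → ℝ)
    (a : ℝ) :
    ∫ s in Set.Ioo (0 : ℝ) k, (Set.Ici a).indicator
      (fun s => (∂_{(Pi.single j 1 : N → ℝ)} g : 𝓓(openBox N k, ℝ)) (Function.update w j s)) s =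
      - g (Function.update w j a) := by
  set f : ℝ → ℝ := fun s => g (Function.update w j s) with hf
  have hup : ContDiff ℝ 1 (fun s : ℝ => Function.update w j s) := contDiff_update 1 w j
  have hfd : ContDiff ℝ 1 f := (g.contDiff.of_le (by simp)).comp hup
  have hout : ∀ (h : 𝓓(openBox N k, ℝ)) (s : ℝ), s ∉ Set.Ioo (0 : ℝ) k →
      h (Function.update w j s) = 0 := fun h s hs =>
    eq_zero_of_notMem_openBox h fun hz => hs (by simpa using mem_openBox.1 hz j)
  have hfc : HasCompactSupport f := HasCompactSupport.intro (isCompact_Icc (a := (0 : ℝ)) (b := k))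
    fun s hs => hout g s fun h => hs (Set.Ioo_subset_Icc_self h)
  have hderiv : ∀ s, (∂_{(Pi.single j 1 : N → ℝ)} g : 𝓓(openBox N k, ℝ)) (Function.update w j s)
      = deriv f s := by
    intro s
    have hgd : DifferentiableAt ℝ g (Function.update w j s) :=
      (g.contDiff.differentiable (by simp)).differentiableAt
    rw [lineDerivOp_apply_eq, hgd.lineDeriv_eq_fderiv]
    exact ((hgd.hasFDerivAt).comp_hasDerivAt s (hasDerivAt_update w j s)).deriv.symm
  rw [← hfc.integral_Ioi_deriv_eq hfd a, ← integral_Ici_eq_integral_Ioi,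
    ← integral_indicator measurableSet_Ici, ← integral_indicator measurableSet_Ioo]
  congr 1
  funext s
  by_cases hs : s ∈ Set.Ioo (0 : ℝ) k
  · rw [Set.indicator_of_mem hs]
    simp only [Set.indicator, hderiv]
    congr
  · rw [Set.indicator_of_notMem hs]
    by_cases ha : s ∈ Set.Ici a
    · rw [Set.indicator_of_mem ha, ← hderiv, hout _ s hs]
    · rw [Set.indicator_of_notMem ha]

/-- Integrate first along coordinate `j`, where the constraint is the half-line `c j + t ≤ s`: only
the value at the endpoint `c j + t` survives, which moves `j` into the face directions. -/
theorem integral_lineDeriv_faceMeasure {k : ℕ} (g : 𝓓(openBox N k, ℝ)) {T : Finset N} {j : N}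
    (hj : j ∉ T) (c : N → ℝ) :
    ∫ z, (∂_{(Pi.single j 1 : N → ℝ)} g : 𝓓(openBox N k, ℝ)) z ∂(faceMeasure k T c) =
      - ∫ z, g z ∂(faceMeasure k (insert j T) c) := by
  set h : 𝓓(openBox N k, ℝ) := ∂_{(Pi.single j 1 : N → ℝ)} g with hh
  obtain ⟨C, hC⟩ := exists_norm_le h
  obtain ⟨C', hC'⟩ := exists_norm_le g
  rw [integral_faceMeasure k T c h.continuous.measurable hC,
    integral_faceMeasure k (insert j T) c g.continuous.measurable hC', ← integral_neg]
  congr 1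
  funext t
  rw [← integral_neg]
  have hmp := measurePreserving_update_pi (faceBase k T) j (Measure.dirac (0 : ℝ))
  rw [← faceBase_insert] at hmp
  set F : (N → ℝ) → ℝ := fun z =>
    (faceRegion T c).indicator (fun p => h (facePoint T c p.1 p.2)) (t, z) with hF
  have hFm : Measurable F :=
    ((h.continuous.measurable.comp (measurable_facePoint T c)).indicator
      (measurableSet_faceRegion T c)).comp measurable_prodMk_left
  have hFb : ∀ z, ‖F z‖ ≤ C := fun z => (norm_indicator_le_norm_self _ _).trans (hC _)
  rw [← hmp.map_eq, integral_map hmp.measurable.aemeasurable hFm.aestronglyMeasurable,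
    integral_prod_symm (fun p : ℝ × (N → ℝ) => F (Function.update p.2 j p.1))
      (Integrable.of_bound (hFm.comp hmp.measurable).aestronglyMeasurable C
        (.of_forall fun p => hFb _))]
  congr 1
  funext z
  have hreg : ∀ s : ℝ, (t, Function.update z j s) ∈ faceRegion T c ↔
      (t, z) ∈ faceRegion (insert j T) c ∧ c j + t ≤ s := by
    intro s
    simp only [faceRegion, Set.mem_ofPred_eq, Finset.mem_insert, not_or]
    constructor
    · intro H
      exact ⟨fun i hi => by simpa [hi.1] using H i hi.2, by simpa using H j hj⟩
    · rintro ⟨H1, H2⟩ i hi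
      by_cases hij : i = j
      · subst hij; simpa using H2
      · simpa [hij] using H1 i ⟨hij, hi⟩
  have hpt : ∀ s : ℝ, facePoint T c t (Function.update z j s) =
      Function.update (facePoint (insert j T) c t z) j s := by
    intro s
    funext i
    by_cases hij : i = j
    · subst hij; simp [facePoint, hj]
    · simp [facePoint, hij]
  have hpt' : Function.update (facePoint (insert j T) c t z) j (c j + t) =
      facePoint (insert j T) c t z := by
    rw [Function.update_eq_self_iff]; simp [facePoint]
  have hb : faceBase k T j = volume.restrict (Set.Ioo (0 : ℝ) k) := by simp [faceBase, hj]
  by_cases hz : (t, z) ∈ faceRegion (insert j T) c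
  · rw [Set.indicator_of_mem hz, ← hpt', ← integral_Ioo_lineDeriv_update g j _ (c j + t), hb]
    congr 1
    funext s
    simp only [hF, Set.indicator, hreg, hz, true_and, hpt, Set.mem_Ici]
    congr
  · rw [Set.indicator_of_notMem hz, neg_zero]
    simp [hF, Set.indicator, hreg, hz]

end FaceMeasure

/-! ### Averaged orthant indicators -/

section Step

variable {N : Type*} [Fintype N] [DecidableEq N]

/-- The length of `{t ∈ (0,1) : c i + t ≤ z i for all i}`. -/
def stepMean (c z : N → ℝ) : ℝ := volume.real {t : ℝ | t ∈ Set.Ioo 0 1 ∧ ∀ i, c i + t ≤ z i}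

theorem measurableSet_stepMean (c z : N → ℝ) :
    MeasurableSet {t : ℝ | t ∈ Set.Ioo (0 : ℝ) 1 ∧ ∀ i, c i + t ≤ z i} := by
  refine measurableSet_Ioo.inter ?_
  have : {t : ℝ | ∀ i, c i + t ≤ z i} = ⋂ i, {t : ℝ | c i + t ≤ z i} := by ext; simp
  change MeasurableSet {t : ℝ | ∀ i, c i + t ≤ z i}
  rw [this]
  exact MeasurableSet.iInter fun i => measurableSet_le (by fun_prop) (by fun_prop)

theorem stepMean_nonneg (c z : N → ℝ) : 0 ≤ stepMean c z := measureReal_nonneg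

theorem stepMean_le_one (c z : N → ℝ) : stepMean c z ≤ 1 := by
  calc stepMean c z ≤ volume.real (Set.Ioo (0 : ℝ) 1) :=
        measureReal_mono (fun t ht => ht.1) (by simp)
    _ = 1 := by simp

/-- If `t` is admissible for `z`, then `t - dist z w` is admissible for `w` unless `t ≤ dist z w`.
Averaging along the diagonal thus makes the discontinuous orthant indicators Lipschitz. -/
theorem stepMean_le_add_dist (c z w : N → ℝ) : stepMean c z ≤ stepMean c w + dist z w := by
  have hsub : {t : ℝ | t ∈ Set.Ioo (0 : ℝ) 1 ∧ ∀ i, c i + t ≤ z i} ⊆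
      (fun t => t - dist z w) ⁻¹' {t : ℝ | t ∈ Set.Ioo (0 : ℝ) 1 ∧ ∀ i, c i + t ≤ w i} ∪
        Set.Ioc 0 (dist z w) := by
    rintro t ⟨ht, hz⟩
    by_cases hd : t ≤ dist z w
    · exact Or.inr ⟨ht.1, hd⟩
    · left
      have h0 : 0 ≤ dist z w := dist_nonneg
      refine ⟨⟨by linarith, by linarith [ht.2]⟩, fun i => ?_⟩
      have h1 := dist_le_pi_dist z w i
      rw [Real.dist_eq] at h1
      have := hz i
      have := le_abs_self (z i - w i)
      linarith
  have hpre : volume ((fun t => t - dist z w) ⁻¹'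
      {t : ℝ | t ∈ Set.Ioo (0 : ℝ) 1 ∧ ∀ i, c i + t ≤ w i}) =
      volume {t : ℝ | t ∈ Set.Ioo (0 : ℝ) 1 ∧ ∀ i, c i + t ≤ w i} :=
    (measurePreserving_sub_right volume (dist z w)).measure_preimage
      (measurableSet_stepMean c w).nullMeasurableSet
  have hfin : volume {t : ℝ | t ∈ Set.Ioo (0 : ℝ) 1 ∧ ∀ i, c i + t ≤ w i} ≠ ⊤ :=
    ((measure_mono fun t ht => ht.1).trans_lt (by simp : volume (Set.Ioo (0 : ℝ) 1) < ⊤)).ne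
  calc stepMean c z ≤ _ := measureReal_mono hsub (by
        refine (measure_union_lt_top ?_ (by simp)).ne
        rw [hpre]; exact hfin.lt_top)
    _ ≤ _ := measureReal_union_le _ _
    _ = stepMean c w + dist z w := by
        congr 1
        · simp only [Measure.real, stepMean, hpre]
        · simp

theorem lipschitzWith_stepMean (c : N → ℝ) : LipschitzWith 1 (stepMean c) :=
  LipschitzWith.of_le_add fun z w => stepMean_le_add_dist c z w

theorem stepMean_eq_integral (c z : N → ℝ) :
    stepMean c z = ∫ t in Set.Ioo (0 : ℝ) 1, ∏ i, if c i + t ≤ z i then (1 : ℝ) else 0 := by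
  rw [stepMean, ← integral_indicator_one (measurableSet_stepMean c z),
    ← integral_indicator measurableSet_Ioo]
  congr 1
  funext t
  by_cases ht : t ∈ Set.Ioo (0 : ℝ) 1
  · rw [Set.indicator_of_mem ht]
    by_cases h : ∀ i, c i + t ≤ z i
    · rw [Set.indicator_of_mem (show t ∈ {t : ℝ | t ∈ Set.Ioo 0 1 ∧ ∀ i, c i + t ≤ z i} from ⟨ht, h⟩)]
      simp [h]
    · rw [Set.indicator_of_notMem fun h' => h h'.2]
      push Not at h
      obtain ⟨i, hi⟩ := h
      exact (Finset.prod_eq_zero (Finset.mem_univ i) (by simp [hi])).symm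
  · rw [Set.indicator_of_notMem ht, Set.indicator_of_notMem fun h => ht h.1]

theorem measurableSet_openBox (k : ℕ) : MeasurableSet (openBox N k : Set (N → ℝ)) :=
  (openBox N k).isOpen.measurableSet

theorem pi_faceBase_empty (k : ℕ) :
    Measure.pi (faceBase k (∅ : Finset N)) =
      volume.restrict (openBox N k : Set (N → ℝ)) := by
  change _ = volume.restrict (Set.univ.pi fun _ => Set.Ioo (0 : ℝ) k)
  rw [volume_pi, Measure.restrict_pi_pi]
  rfl

/-- By Fubini, `stepMean c` is the density of the face measure for `T = ∅`; this starts the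
induction on derivatives. -/
theorem integral_mul_stepMean (k : ℕ) (c : N → ℝ) {h : (N → ℝ) → ℝ}
    (hm : Measurable h) {C : ℝ} (hC : ∀ z, ‖h z‖ ≤ C) :
    ∫ z in (openBox N k : Set (N → ℝ)), h z * stepMean c z =
      ∫ z, h z ∂(faceMeasure k ∅ c) := by
  rw [integral_faceMeasure k ∅ c hm hC]
  have hpt : ∀ t z, facePoint ∅ c t z = z := fun t z => by funext i; simp [facePoint]
  have hm' : Measurable ((faceRegion ∅ c).indicator
      (fun p : ℝ × (N → ℝ) => h (facePoint ∅ c p.1 p.2))) :=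
    (hm.comp (measurable_facePoint ∅ c)).indicator (measurableSet_faceRegion ∅ c)
  rw [integral_integral_swap (f := fun t z => (faceRegion ∅ c).indicator
      (fun p : ℝ × (N → ℝ) => h (facePoint ∅ c p.1 p.2)) (t, z)), pi_faceBase_empty]
  · congr 1
    funext z
    rw [stepMean_eq_integral, ← integral_const_mul]
    congr 1
    funext t
    by_cases ht : (t, z) ∈ faceRegion ∅ c
    · rw [Set.indicator_of_mem ht]
      have : ∀ i, c i + t ≤ z i := fun i => ht i (by simp)
      simp [this, hpt]
    · rw [Set.indicator_of_notMem ht]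
      have : ∃ i, ¬ c i + t ≤ z i := by
        by_contra! h; exact ht fun i _ => h i
      obtain ⟨i, hi⟩ := this
      rw [Finset.prod_eq_zero (Finset.mem_univ i) (by simp [hi]), mul_zero]
  · exact Integrable.of_bound hm'.aestronglyMeasurable C
      (.of_forall fun p => (norm_indicator_le_norm_self (fun p : ℝ × (N → ℝ) =>
        h (facePoint ∅ c p.1 p.2)) p).trans (hC _))

end Step

/-! ### Masses on the open box and the beta integral -/

section Mass

variable {N : Type*} [Fintype N] [DecidableEq N]

/-- The contribution of the coordinate `i` to the mass of `faceMeasure k T c` on the open box. -/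
def layer (k : ℕ) (T : Finset N) (i : N) (a : ℝ) : ℝ :=
  if i ∈ T then (if a ∈ Set.Ioo (0 : ℝ) k then 1 else 0) else max 0 (k - max a 0)

theorem measurable_layer (k : ℕ) (T : Finset N) (i : N) : Measurable (layer k T i) := by
  unfold layer
  split_ifs
  · exact Measurable.ite measurableSet_Ioo measurable_const measurable_const
  · fun_prop

theorem norm_layer_le (k : ℕ) (T : Finset N) (i : N) (a : ℝ) : ‖layer k T i a‖ ≤ k + 1 := by
  have hk : (0 : ℝ) ≤ k := k.cast_nonneg
  unfold layer
  split_ifs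
  · simp
  · simp; linarith
  · have h1 : (0 : ℝ) ≤ max 0 (k - max a 0) := le_max_left _ _
    rw [Real.norm_of_nonneg h1]
    refine max_le (by linarith) ?_
    have := le_max_right a 0
    linarith

theorem integral_Ioo_ite_le (k : ℕ) (a : ℝ) :
    ∫ s in Set.Ioo (0 : ℝ) k, (if s ∈ Set.Ioo (0 : ℝ) k ∧ a ≤ s then (1 : ℝ) else 0) =
      max 0 (k - max a 0) := by
  have hk : (0 : ℝ) ≤ k := k.cast_nonneg
  have : ∀ s, (if s ∈ Set.Ioo (0 : ℝ) k ∧ a ≤ s then (1 : ℝ) else 0) =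
      (Set.Ioo (0 : ℝ) k ∩ Set.Ici a).indicator 1 s := by
    intro s; simp [Set.indicator]
  simp_rw [this]
  rw [integral_indicator_one (measurableSet_Ioo.inter measurableSet_Ici), Measure.real,
    Measure.restrict_apply (measurableSet_Ioo.inter measurableSet_Ici)]
  rcases le_or_gt a 0 with ha | ha
  · have : Set.Ioo (0 : ℝ) k ∩ Set.Ici a ∩ Set.Ioo (0 : ℝ) k = Set.Ioo (0 : ℝ) k := by
      ext s; simp only [Set.mem_inter_iff, Set.mem_Ioo, Set.mem_Ici]
      constructor
      · tauto
      · intro h; exact ⟨⟨h, by linarith [h.1]⟩, h⟩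
    rw [this, max_eq_right ha]
    simp
  · have : Set.Ioo (0 : ℝ) k ∩ Set.Ici a ∩ Set.Ioo (0 : ℝ) k = Set.Ico a k := by
      ext s; simp only [Set.mem_inter_iff, Set.mem_Ioo, Set.mem_Ici, Set.mem_Ico]
      constructor
      · rintro ⟨⟨h, h2⟩, -⟩; exact ⟨h2, h.2⟩
      · intro h
        have : 0 < s := by linarith [h.1]
        exact ⟨⟨⟨this, h.2⟩, h.1⟩, ⟨this, h.2⟩⟩
    rw [this, max_eq_left ha.le, Real.volume_Ico, ENNReal.toReal_ofReal', max_comm]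

/-- For fixed `t` both constraints, lying in the region and in the box, are coordinatewise, so the
mass factors. -/
theorem faceMeasure_real_openBox (k : ℕ) (T : Finset N) (c : N → ℝ) :
    (faceMeasure k T c).real (openBox N k : Set (N → ℝ)) =
      ∫ t in Set.Ioo (0 : ℝ) 1, ∏ i, layer k T i (c i + t) := by
  rw [← integral_indicator_one (measurableSet_openBox k),
    integral_faceMeasure k T c (measurable_one.indicator (measurableSet_openBox k)) (C := 1)]
  · congr 1
    funext t
    have : ∀ z : N → ℝ, (faceRegion T c).indicator (fun p =>
        (openBox N k : Set (N → ℝ)).indicator (1 : (N → ℝ) → ℝ) (facePoint T c p.1 p.2)) (t, z) =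
        ∏ i, (if i ∈ T then (if c i + t ∈ Set.Ioo (0 : ℝ) k then (1 : ℝ) else 0)
          else if z i ∈ Set.Ioo (0 : ℝ) k ∧ c i + t ≤ z i then 1 else 0) := by
      intro z
      by_cases h : (t, z) ∈ faceRegion T c ∧ facePoint T c t z ∈ openBox N k
      · rw [Set.indicator_of_mem h.1, Set.indicator_of_mem (by exact h.2)]
        refine (Finset.prod_eq_one fun i _ => ?_).symm
        have h2 := mem_openBox.1 h.2 i
        by_cases hi : i ∈ T
        · simp only [facePoint, hi, if_true] at h2 ⊢
          rw [if_pos h2]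
        · simp only [facePoint, hi, if_false] at h2 ⊢
          rw [if_pos ⟨h2, h.1 i hi⟩]
      · have hz : ∃ i, (if i ∈ T then (if c i + t ∈ Set.Ioo (0 : ℝ) k then (1 : ℝ) else 0)
            else if z i ∈ Set.Ioo (0 : ℝ) k ∧ c i + t ≤ z i then 1 else 0) = 0 := by
          by_contra! hne
          refine h ⟨fun i hi => ?_, mem_openBox.2 fun i => ?_⟩
          · by_contra h2
            exact hne i (by simp [hi, h2])
          · by_contra h2
            unfold facePoint at h2
            by_cases hi : i ∈ T
            · rw [if_pos hi] at h2
              exact hne i (by rw [if_pos hi, if_neg h2])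
            · rw [if_neg hi] at h2
              exact hne i (by rw [if_neg hi, if_neg fun h => h2 h.1])
        obtain ⟨i, hi⟩ := hz
        rw [Finset.prod_eq_zero (Finset.mem_univ i) hi]
        by_cases h1 : (t, z) ∈ faceRegion T c
        · rw [Set.indicator_of_mem h1, Set.indicator_of_notMem fun h2 => h ⟨h1, h2⟩]
        · rw [Set.indicator_of_notMem h1]
    simp_rw [this]
    rw [integral_fintype_prod_eq_prod (f := fun i (s : ℝ) =>
      (if i ∈ T then (if c i + t ∈ Set.Ioo (0 : ℝ) k then (1 : ℝ) else 0)
          else if s ∈ Set.Ioo (0 : ℝ) k ∧ c i + t ≤ s then 1 else 0))]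
    refine Finset.prod_congr rfl fun i _ => ?_
    unfold layer faceBase
    by_cases hi : i ∈ T
    · simp [hi]
    · simp only [hi, if_false]
      exact integral_Ioo_ite_le k _
  · intro z
    refine (norm_indicator_le_norm_self _ _).trans (by simp)

/-- The lower left corner, up to the shift by `t`, of the orthants into which the cell of `x`
is decomposed. -/
def offset {k : ℕ} (x : N → Fin (k + 1)) (B : Finset N) : N → ℝ :=
  fun i => ((x i : ℕ) : ℝ) - 1 + if i ∈ B then 1 else 0

/-- Here `B` collects the coordinates where the subtracted term is chosen. The identity serves
twice: with half-line indicators for `C_v`, with `layer` for masses. -/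
theorem prod_sub_offset {k : ℕ} (x : N → Fin (k + 1)) (f : N → ℝ → ℝ) (t : ℝ) :
    ∑ B : Finset N, (-1 : ℝ) ^ B.card * ∏ i, f i (offset x B i + t) =
      ∏ i, (f i (((x i : ℕ) : ℝ) - 1 + t) - f i (((x i : ℕ) : ℝ) + t)) := by
  rw [Finset.prod_sub, Finset.powerset_univ]
  refine Finset.sum_congr rfl fun B _ => ?_
  rw [mul_assoc, ← Finset.prod_sdiff (Finset.subset_univ B)]
  congr 2
  · refine Finset.prod_congr rfl fun i hi => ?_
    simp [offset, (Finset.mem_sdiff.1 hi).2]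
  · refine Finset.prod_congr rfl fun i hi => ?_
    simp [offset, hi]

/-- Outside `T` the difference is the length of `[x - 1 + t, x + t)` inside `(0, k)`. In `T` it
compares whether the two endpoints lie in `(0, k)`, which differs only for `x = 0` and `x = k`;
these are distinct by `hk`. -/
theorem layer_sub_layer {k : ℕ} (hk : k ≠ 0) (T : Finset N) (i : N) (x : Fin (k + 1)) {t : ℝ}
    (ht : t ∈ Set.Ioo (0 : ℝ) 1) :
    layer k T i (((x : ℕ) : ℝ) - 1 + t) - layer k T i (((x : ℕ) : ℝ) + t) =
      if i ∈ T then (if x = Fin.last k then 1 else if x = 0 then -1 else 0)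
      else (if x = 0 then t else 1) * (if x = Fin.last k then 1 - t else 1) := by
  obtain ⟨m, hm⟩ := x
  have hk1 : (1 : ℝ) ≤ k := by exact_mod_cast Nat.one_le_iff_ne_zero.2 hk
  have h0 : (⟨m, hm⟩ : Fin (k + 1)) = 0 ↔ m = 0 := by simp [Fin.ext_iff]
  have hl : (⟨m, hm⟩ : Fin (k + 1)) = Fin.last k ↔ m = k := by simp [Fin.ext_iff]
  simp only [h0, hl]
  obtain ⟨ht0, ht1⟩ := ht
  have hm0 : m ≠ 0 → (1 : ℝ) ≤ m := fun h => by exact_mod_cast Nat.one_le_iff_ne_zero.2 h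
  have hmk : m ≠ k → (m : ℝ) + 1 ≤ k := fun h => by
    exact_mod_cast (by omega : m + 1 ≤ k)
  have hmle : (m : ℝ) ≤ k := by exact_mod_cast (by omega : m ≤ k)
  unfold layer
  by_cases hi : i ∈ T
  · simp only [hi, if_true, Set.mem_Ioo]
    by_cases h1 : m = k
    · subst h1
      rw [if_pos ⟨by linarith, by linarith⟩, if_neg fun h => by linarith [h.2]]
      simp
    · have := hmk h1
      rw [if_pos (show 0 < (m : ℝ) + t ∧ (m : ℝ) + t < k from
        ⟨by have : (0 : ℝ) ≤ m := m.cast_nonneg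
            linarith, by linarith⟩), if_neg h1]
      by_cases h2 : m = 0
      · subst h2
        rw [if_neg fun h => by have := h.1; push_cast at this; linarith]
        simp
      · have := hm0 h2
        rw [if_pos ⟨by linarith, by linarith⟩]
        simp [h2]
  · simp only [hi, if_false]
    by_cases h2 : m = 0
    · have h1 : m ≠ k := by omega
      rw [if_pos h2, if_neg h1]
      subst h2
      rw [max_eq_right (by push_cast; linarith : ((0 : ℕ) : ℝ) - 1 + t ≤ 0),
        max_eq_left (by push_cast; linarith : 0 ≤ ((0 : ℕ) : ℝ) + t),
        max_eq_right (by linarith), max_eq_right (by push_cast; linarith)]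
      push_cast; ring
    · have := hm0 h2
      rw [if_neg h2, max_eq_left (by linarith : 0 ≤ (m : ℝ) - 1 + t),
        max_eq_left (by linarith : 0 ≤ (m : ℝ) + t),
        max_eq_right (by linarith : (0 : ℝ) ≤ k - (m - 1 + t))]
      by_cases h1 : m = k
      · rw [if_pos h1, max_eq_left (by rw [h1]; linarith), h1]; ring
      · have := hmk h1
        rw [if_neg h1, max_eq_right (by linarith)]; ring

theorem integral_pow_mul_one_sub_pow (a b : ℕ) :
    ∫ t in Set.Ioo (0 : ℝ) 1, t ^ a * (1 - t) ^ b =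
      ((a ! * b ! : ℕ) : ℝ) / (((a + b + 1)! : ℕ) : ℝ) := by
  have h := Complex.betaIntegral_eq_Gamma_mul_div (a + 1) (b + 1)
    (by simp; positivity) (by simp; positivity)
  rw [Complex.Gamma_nat_eq_factorial, Complex.Gamma_nat_eq_factorial,
    show ((a : ℂ) + 1 + (b + 1)) = ((a + b + 1 : ℕ) : ℂ) + 1 by push_cast; ring,
    Complex.Gamma_nat_eq_factorial] at h
  have h2 : Complex.betaIntegral (a + 1) (b + 1) =
      ((∫ t in (0 : ℝ)..1, t ^ a * (1 - t) ^ b : ℝ) : ℂ) := by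
    rw [Complex.betaIntegral, ← intervalIntegral.integral_ofReal]
    congr 1
    funext t
    simp
  rw [← integral_Ioc_eq_integral_Ioo, ← intervalIntegral.integral_of_le zero_le_one]
  rw [h2] at h
  refine Complex.ofReal_injective ?_
  rw [h]
  push_cast
  rfl

theorem integral_layers {k : ℕ} (hk : k ≠ 0) (T : Finset N) (x : N → Fin (k + 1)) :
    ∑ B : Finset N, (-1 : ℝ) ^ B.card *
        (faceMeasure k T (offset x B)).real (openBox N k : Set (N → ℝ)) =
      (∏ i ∈ T, if x i = Fin.last k then 1 else if x i = 0 then -1 else 0) *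
        ∫ t in Set.Ioo (0 : ℝ) 1, (∏ i ∈ Tᶜ, if x i = 0 then t else 1) *
          ∏ i ∈ Tᶜ, if x i = Fin.last k then 1 - t else 1 := by
  simp_rw [faceMeasure_real_openBox, ← integral_const_mul]
  rw [← integral_finsetSum]
  · refine setIntegral_congr_fun measurableSet_Ioo fun t ht => ?_
    rw [prod_sub_offset x (layer k T) t, ← Finset.prod_mul_prod_compl T, ← Finset.prod_mul_distrib]
    congr 1
    · refine Finset.prod_congr rfl fun i hi => ?_
      rw [layer_sub_layer hk T i _ ht, if_pos hi]
    · refine Finset.prod_congr rfl fun i hi => ?_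
      rw [layer_sub_layer hk T i _ ht, if_neg (Finset.mem_compl.1 hi)]
  · intro B _
    refine (Integrable.of_bound (C := ∏ _i : N, ((k : ℝ) + 1)) ?_
      (.of_forall fun t => ?_)).const_mul _
    · exact (Finset.measurable_prod _ fun i _ =>
        (measurable_layer k T i).comp (by fun_prop)).aestronglyMeasurable
    · rw [norm_prod]
      exact Finset.prod_le_prod (fun _ _ => norm_nonneg _) fun i _ => norm_layer_le k T i _

/-- Only points with all `T`-coordinates in `{0, k}` contribute, and each is `compound T A x` for
exactly one pair `(x, A)`. -/
theorem sum_faceMeasure_openBox {k : ℕ} (hk : k ≠ 0) (v : (N → Fin (k + 1)) → ℝ) (T : Finset N) :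
    ∑ x, v x * ∑ B : Finset N, (-1 : ℝ) ^ B.card *
        (faceMeasure k T (offset x B)).real (openBox N k : Set (N → ℝ)) = interaction v T := by
  simp_rw [integral_layers hk, interaction, Finset.mul_sum]
  rw [← Finset.univ.sum_product' T.powerset (f := fun x A =>
    (((Fintype.card N - suppCard T x - T.card)! * (kerCard T x)! : ℕ) : ℝ) /
        (((Fintype.card N - suppCard T x + kerCard T x - T.card + 1)! : ℕ) : ℝ) *
      ((-1 : ℝ) ^ (T.card - A.card) * v (compound T A x)))]
  have hlast : Fin.last k ≠ 0 := by
    intro h; exact hk (by simpa [Fin.ext_iff] using h)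
  symm
  refine Finset.sum_of_injOn (fun p => compound T p.2 p.1) ?_ (by simp) ?_ ?_
  · rintro ⟨x, A⟩ hA ⟨y, B⟩ hB h
    simp only [Finset.coe_product, Set.mem_prod, Finset.mem_coe, Finset.mem_powerset] at hA hB
    simp only at h
    refine Prod.ext ?_ ?_
    · funext i
      simpa [compound, i.2] using congrFun h i
    · ext i
      by_cases hi : i ∈ T
      · have := congrFun h i
        simp only [compound, hi, dite_true] at this
        by_cases h1 : i ∈ A <;> by_cases h2 : i ∈ B <;> simp_all
      · exact ⟨fun h => absurd (hA.2 h) hi, fun h => absurd (hB.2 h) hi⟩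
  -- A point that is not of this form has a coordinate in `T` strictly between `0` and `k`, which
  -- gives a zero factor.
  · intro x _ hx
    have : ∃ i ∈ T, x i ≠ Fin.last k ∧ x i ≠ 0 := by
      by_contra! hne
      refine hx ⟨(fun i => x i, T.filter fun i => x i = Fin.last k),
        Finset.mem_coe.2 (Finset.mem_product.2
          ⟨Finset.mem_univ _, Finset.mem_powerset.2 (Finset.filter_subset _ _)⟩), ?_⟩
      funext i
      by_cases hi : i ∈ T
      · by_cases h : x i = Fin.last k
        · simp [compound, hi, h]
        · simp [compound, hi, hne i hi h]
      · simp [compound, hi]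
    obtain ⟨i, hi, h1, h2⟩ := this
    rw [Finset.prod_eq_zero hi (by simp [h1, h2])]
    simp
  · rintro ⟨x, A⟩ hA
    simp only [Finset.mem_product, Finset.mem_univ, true_and, Finset.mem_powerset] at hA
    simp only
    have hsign : (∏ i ∈ T, if compound T A x i = Fin.last k then (1 : ℝ)
        else if compound T A x i = 0 then -1 else 0) = (-1) ^ (T.card - A.card) := by
      rw [← Finset.card_sdiff_of_subset hA, ← Finset.prod_const,
        ← Finset.prod_sdiff hA]
      rw [Finset.prod_congr rfl (g := fun _ => (1 : ℝ)) (s₁ := A) (s₂ := A), Finset.prod_const_one,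
        mul_one]
      · refine Finset.prod_congr rfl fun i hi => ?_
        have := Finset.mem_sdiff.1 hi
        simp [compound, this.1, this.2, hlast.symm]
      · intro i hi
        simp [compound, hA hi, hi]
    have hcard : ∀ (P : Fin (k + 1) → Prop) [DecidablePred P] (s : ℝ),
        (∏ i ∈ Tᶜ, if P (compound T A x i) then s else 1) =
          s ^ (Finset.univ.filter fun i => P (x i)).card := by
      intro P _ s
      rw [← Finset.prod_const, Finset.prod_filter]
      rw [Finset.prod_subtype (p := fun i => i ∉ T) Tᶜ (by simp)
        (fun i => if P (compound T A x i) then s else 1)]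
      refine Finset.prod_congr rfl fun i _ => ?_
      simp [compound, i.2]
    simp_rw [hsign, hcard (fun y => y = 0), hcard (fun y => y = Fin.last k)]
    rw [integral_pow_mul_one_sub_pow]
    -- The exponent of `t` in the beta integral counts the zero coordinates outside `T`, namely `n -
    -- s - t`.
    have hz : (Finset.univ.filter fun i => x i = 0).card + suppCard T x + T.card =
        Fintype.card N := by
      rw [suppCard, Finset.card_filter_add_card_filter_not]
      rw [Finset.card_univ, Fintype.card_subtype_compl]
      simp [Finset.card_le_univ]
    rw [show Fintype.card N - suppCard T x - T.card = (Finset.univ.filter fun i => x i = 0).card by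
        omega, show Fintype.card N - suppCard T x + kerCard T x - T.card + 1 =
        (Finset.univ.filter fun i => x i = 0).card + kerCard T x + 1 by omega]
    simp only [kerCard]
    ring

end Mass

/-! ### Orthant decomposition of the Choquet extension -/

section Choquet

variable {N : Type*} [Fintype N] [DecidableEq N]

theorem ite_sub_ite_eq_level {k : ℕ} (x : Fin (k + 1)) {z t : ℝ} (hz : z ∈ Set.Ioo (0 : ℝ) k)
    (ht : t ∈ Set.Ioo (0 : ℝ) 1) (P : Prop) [Decidable P]
    (hP : P ↔ t ≤ z - ((level k ⌊z⌋₊ : ℕ) : ℝ)) :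
    ((if ((x : ℕ) : ℝ) - 1 + t ≤ z then (1 : ℝ) else 0) -
      if ((x : ℕ) : ℝ) + t ≤ z then 1 else 0) =
      if (if P then level k ((level k ⌊z⌋₊ : ℕ) + 1) else level k ⌊z⌋₊) = x then 1 else 0 := by
  obtain ⟨m, hm⟩ := x
  obtain ⟨hz0, hzk⟩ := hz
  obtain ⟨ht0, ht1⟩ := ht
  have hq : ⌊z⌋₊ < k := (Nat.floor_lt hz0.le).2 hzk
  have h1 := Nat.floor_le hz0.le
  have h2 := Nat.lt_floor_add_one z
  set q := ⌊z⌋₊ with hqd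
  have hlev : ((level k q : Fin (k + 1)) : ℕ) = q := by simp [level, hq.le]
  rw [hlev] at hP ⊢
  -- The intervals `[r - 1 + t, r + t)` are disjoint, so `z` determines `r`; below, `r` is `q + 1`
  -- or `q`. Since `z < k`, `q + 1 ≤ k` and `level` does not truncate.
  have key : ∀ r : ℕ, r ≤ k → ((r : ℝ) - 1 + t ≤ z) → (z < r + t) →
      ((if (m : ℝ) - 1 + t ≤ z then (1 : ℝ) else 0) - if (m : ℝ) + t ≤ z then 1 else 0) =
      if level k r = ⟨m, hm⟩ then 1 else 0 := by
    intro r hr hr1 hr2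
    have he : (level k r = ⟨m, hm⟩) ↔ r = m := by simp [level, Fin.ext_iff, hr]
    simp only [he]
    rcases lt_trichotomy r m with h | h | h
    · have : (r : ℝ) + 1 ≤ m := by exact_mod_cast h
      rw [if_neg (by linarith), if_neg (by linarith), if_neg h.ne, sub_zero]
    · subst h
      rw [if_pos hr1, if_neg (by linarith), if_pos rfl, sub_zero]
    · have : (m : ℝ) + 1 ≤ r := by exact_mod_cast h
      rw [if_pos (by linarith), if_pos (by linarith), if_neg h.ne', sub_self]
  by_cases h : P
  · rw [if_pos h]
    have := hP.1 h
    exact key (q + 1) hq (by push_cast; linarith) (by push_cast; linarith)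
  · rw [if_neg h]
    have : ¬ (t ≤ z - q) := fun h' => h (hP.2 h')
    exact key q hq.le (by linarith) (by linarith)

theorem integrable_prod_ite (c z : N → ℝ) :
    IntegrableOn (fun t : ℝ => ∏ i, if c i + t ≤ z i then (1 : ℝ) else 0) (Set.Ioo 0 1) := by
  refine Integrable.of_bound (C := 1) (Finset.measurable_prod _ fun i _ =>
    Measurable.ite (measurableSet_le (by fun_prop) (by fun_prop)) measurable_const
      measurable_const).aestronglyMeasurable (.of_forall fun t => ?_)
  rw [norm_prod]
  refine Finset.prod_le_one (fun _ _ => norm_nonneg _) fun i _ => ?_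
  split_ifs <;> simp

/-- A Lipschitz function on `ℝ^N` that agrees with `choquetExt v` on the open box. -/
def choquetLipschitz {k : ℕ} (v : (N → Fin (k + 1)) → ℝ) (z : N → ℝ) : ℝ :=
  ∑ x, v x * ∑ B : Finset N, (-1 : ℝ) ^ B.card * stepMean (offset x B) z

theorem choquetExt_eq {k : ℕ} (v : (N → Fin (k + 1)) → ℝ) {z : N → ℝ} (hz : z ∈ openBox N k) :
    choquetExt v z = choquetLipschitz v z := by
  have hz' := mem_openBox.1 hz
  have hw1 : ∀ i, z i - ((gridFloor k z i : ℕ) : ℝ) < 1 := by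
    intro i
    have hq : ⌊z i⌋₊ < k := (Nat.floor_lt (hz' i).1.le).2 (hz' i).2
    have : ((gridFloor k z i : Fin (k + 1)) : ℕ) = ⌊z i⌋₊ := by simp [gridFloor, level, hq.le]
    rw [this]
    linarith [Nat.lt_floor_add_one (z i)]
  have hsum : ∀ t ∈ Set.Ioo (0 : ℝ) 1, cellGame v (gridFloor k z)
      (Finset.univ.filter fun i => t ≤ z i - ((gridFloor k z i : ℕ) : ℝ)) =
      (∑ x, v x * ∑ B : Finset N, (-1 : ℝ) ^ B.card *
        ∏ i, if offset x B i + t ≤ z i then (1 : ℝ) else 0) - v (gridFloor k z) := by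
    intro t ht
    rw [cellGame]
    congr 1
    set p : N → Fin (k + 1) := fun i =>
      if i ∈ Finset.univ.filter (fun i => t ≤ z i - ((gridFloor k z i : ℕ) : ℝ)) then
        level k ((gridFloor k z i : ℕ) + 1) else gridFloor k z i with hp
    have hx : ∀ x : N → Fin (k + 1), (∑ B : Finset N, (-1 : ℝ) ^ B.card *
        ∏ i, if offset x B i + t ≤ z i then (1 : ℝ) else 0) = if p = x then 1 else 0 := by
      intro x
      rw [prod_sub_offset x (fun i a => if a ≤ z i then (1 : ℝ) else 0) t]
      have : ∀ i, ((if ((x i : ℕ) : ℝ) - 1 + t ≤ z i then (1 : ℝ) else 0) -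
          if ((x i : ℕ) : ℝ) + t ≤ z i then 1 else 0) = if p i = x i then 1 else 0 := fun i =>
        ite_sub_ite_eq_level (x i) (hz' i) ht _
          (Finset.mem_filter.trans (by simp [gridFloor]))
      simp_rw [this]
      by_cases h : p = x
      · simp [h]
      · rw [if_neg h]
        obtain ⟨i, hi⟩ := Function.ne_iff.1 h
        exact Finset.prod_eq_zero (Finset.mem_univ i) (by simp [hi])
    simp [hx]
  have hempty : cellGame v (gridFloor k z) ∅ = 0 := by simp [cellGame]
  -- All fractional parts are below `1`, so the level sets are empty for `t ≥ 1`. On the remaining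
  -- unit interval the term `-v q` of `cellGame` integrates to exactly what cancels the leading `v
  -- q`.
  rw [choquetExt, choquetIntegral, setIntegral_eq_of_subset_of_forall_sdiff_eq_zero
    (s := Set.Ioo (0 : ℝ) 1) measurableSet_Ioi (fun t ht => ht.1),
    setIntegral_congr_fun measurableSet_Ioo hsum, integral_sub, integral_finsetSum]
  · simp only [choquetLipschitz, integral_const_mul]
    simp_rw [stepMean_eq_integral, ← integral_const_mul]
    have : ∀ x : N → Fin (k + 1), ∫ t in Set.Ioo (0 : ℝ) 1, ∑ B : Finset N, (-1 : ℝ) ^ B.card *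
        (∏ i, if offset x B i + t ≤ z i then (1 : ℝ) else 0) =
        ∑ B : Finset N, ∫ t in Set.Ioo (0 : ℝ) 1, (-1 : ℝ) ^ B.card *
        (∏ i, if offset x B i + t ≤ z i then (1 : ℝ) else 0) := fun x =>
      integral_finsetSum _ fun B _ => (integrable_prod_ite _ z).const_mul _
    simp [integral_const_mul, this]
  · exact fun x _ => (integrable_finsetSum _ fun B _ =>
      (integrable_prod_ite _ z).const_mul _).const_mul _
  · exact integrable_finsetSum _ fun x _ => (integrable_finsetSum _ fun B _ =>
      (integrable_prod_ite _ z).const_mul _).const_mul _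
  · exact integrable_const _
  · intro t ht
    have h1 : 1 ≤ t := by
      by_contra! h
      exact ht.2 ⟨ht.1, h⟩
    rw [Finset.filter_false_of_mem, hempty]
    intro i _
    have := hw1 i
    linarith

theorem exists_lipschitzWith_sum {ι E : Type*} [PseudoEMetricSpace E] (s : Finset ι) (a : ι → ℝ)
    (f : ι → E → ℝ) (hf : ∀ i, ∃ C, LipschitzWith C (f i)) :
    ∃ C, LipschitzWith C (fun z => ∑ i ∈ s, a i * f i z) := by
  classical
  induction s using Finset.induction_on with
  | empty => exact ⟨0, by simp⟩
  | insert i s hi ih =>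
    obtain ⟨C, hC⟩ := ih
    obtain ⟨C', hC'⟩ := hf i
    simp_rw [Finset.sum_insert hi]
    exact ⟨_, ((lipschitzWith_smul (a i)).comp hC').add hC⟩

theorem exists_lipschitzWith_choquetLipschitz {k : ℕ} (v : (N → Fin (k + 1)) → ℝ) :
    ∃ C, LipschitzWith C (choquetLipschitz v) :=
  exists_lipschitzWith_sum _ _ _ fun _ => exists_lipschitzWith_sum _ _ _ fun _ =>
    ⟨1, lipschitzWith_stepMean _⟩

theorem continuous_choquetLipschitz {k : ℕ} (v : (N → Fin (k + 1)) → ℝ) :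
    Continuous (choquetLipschitz v) :=
  (exists_lipschitzWith_choquetLipschitz v).choose_spec.continuous

theorem closedBox_eq_Icc (k : ℕ) : closedBox N k = Set.Icc (fun _ => 0) (fun _ => (k : ℝ)) := by
  rw [closedBox, Set.pi_univ_Icc]

theorem openBox_ae_eq_closedBox (k : ℕ) :
    (openBox N k : Set (N → ℝ)) =ᵐ[volume] closedBox N k := by
  rw [closedBox_eq_Icc]
  exact Measure.univ_pi_Ioo_ae_eq_Icc

theorem restrict_closedBox (k : ℕ) :
    (volume : Measure (N → ℝ)).restrict (closedBox N k) =
      volume.restrict (openBox N k : Set (N → ℝ)) :=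
  (Measure.restrict_congr_set (openBox_ae_eq_closedBox k)).symm

theorem volume_openBox_lt_top (k : ℕ) : volume (openBox N k : Set (N → ℝ)) < ⊤ := by
  rw [measure_congr (openBox_ae_eq_closedBox k), closedBox_eq_Icc]
  exact isCompact_Icc.measure_lt_top

theorem integrableOn_choquetExt_openBox {k : ℕ} (v : (N → Fin (k + 1)) → ℝ) :
    IntegrableOn (choquetExt v) (openBox N k : Set (N → ℝ)) := by
  rw [integrableOn_congr_fun (fun z hz => choquetExt_eq v hz) (measurableSet_openBox k)]
  have : IntegrableOn (choquetLipschitz v) (closedBox N k) := by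
    rw [closedBox_eq_Icc]
    exact (continuous_choquetLipschitz v).continuousOn.integrableOn_compact isCompact_Icc
  rwa [IntegrableOn, restrict_closedBox] at this

theorem integrableOn_choquetExt {k : ℕ} (v : (N → Fin (k + 1)) → ℝ) :
    IntegrableOn (choquetExt v) (closedBox N k) := by
  rw [IntegrableOn, restrict_closedBox]
  exact integrableOn_choquetExt_openBox v

end Choquet

/-! ### The mixed derivative as a signed measure -/

section Representation

variable {N : Type*} [Fintype N] [DecidableEq N]

theorem toDistribution_choquetExt_apply {k : ℕ} (v : (N → Fin (k + 1)) → ℝ)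
    (g : 𝓓(openBox N k, ℝ)) :
    toDistribution (openBox N k) (choquetExt v) g =
      ∫ z in (openBox N k : Set (N → ℝ)), g z * choquetLipschitz v z := by
  have h : toDistribution (openBox N k) (choquetExt v) g = ∫ z, g z * choquetExt v z :=
    TestFunction.integralAgainstBilinCLM_eq_integral
      (integrableOn_choquetExt_openBox v).locallyIntegrableOn
  rw [h, ← setIntegral_eq_integral_of_forall_compl_eq_zero (s := (openBox N k : Set (N → ℝ)))
    fun z hz => by rw [eq_zero_of_notMem_openBox g hz, zero_mul]]
  exact setIntegral_congr_fun (measurableSet_openBox k) fun z hz => by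
    simp only [choquetExt_eq v hz]

theorem integrable_testFunction {k : ℕ} (g : 𝓓(openBox N k, ℝ)) (μ : Measure (N → ℝ))
    [IsFiniteMeasure μ] : Integrable g μ := by
  obtain ⟨C, hC⟩ := exists_norm_le g
  exact Integrable.of_bound g.continuous.aestronglyMeasurable C (.of_forall hC)

theorem toDistribution_choquetExt_eq_sum {k : ℕ} (v : (N → Fin (k + 1)) → ℝ)
    (g : 𝓓(openBox N k, ℝ)) :
    toDistribution (openBox N k) (choquetExt v) g =
      ∑ x, v x * ∑ B : Finset N, (-1 : ℝ) ^ B.card *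
        ∫ z, g z ∂(faceMeasure k ∅ (offset x B)) := by
  obtain ⟨C, hC⟩ := exists_norm_le g
  have : IsFiniteMeasure (volume.restrict (openBox N k : Set (N → ℝ))) :=
    ⟨by simpa using volume_openBox_lt_top k⟩
  have hint : ∀ c : N → ℝ, IntegrableOn (fun z => g z * stepMean c z)
      (openBox N k : Set (N → ℝ)) := by
    intro c
    refine Integrable.of_bound (C := C) (g.continuous.mul
      (lipschitzWith_stepMean c).continuous).aestronglyMeasurable (.of_forall fun z => ?_)
    rw [norm_mul, Real.norm_of_nonneg (stepMean_nonneg c z)]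
    calc ‖g z‖ * stepMean c z ≤ ‖g z‖ * 1 :=
          mul_le_mul_of_nonneg_left (stepMean_le_one c z) (norm_nonneg _)
      _ ≤ C := by rw [mul_one]; exact hC z
  rw [toDistribution_choquetExt_apply]
  simp_rw [← fun c => integral_mul_stepMean k c g.continuous.measurable hC,
    ← integral_const_mul]
  have hB : ∀ x : N → Fin (k + 1), ∑ B : Finset N,
      ∫ z in (openBox N k : Set (N → ℝ)), (-1 : ℝ) ^ B.card * (g z * stepMean (offset x B) z) =
      ∫ z in (openBox N k : Set (N → ℝ)), ∑ B : Finset N,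
        (-1 : ℝ) ^ B.card * (g z * stepMean (offset x B) z) := fun x =>
    (integral_finsetSum _ fun B _ => (hint _).const_mul _).symm
  simp_rw [hB, ← integral_const_mul]
  rw [← integral_finsetSum _ fun x _ => (integrable_finsetSum _ fun B _ =>
    (hint (offset x B)).const_mul ((-1 : ℝ) ^ B.card)).const_mul (v x)]
  congr 1
  funext z
  simp only [choquetLipschitz, Finset.mul_sum]
  refine Finset.sum_congr rfl fun x _ => Finset.sum_congr rfl fun B _ => ?_
  ring

/-- Arbitrary injective tuples of directions make the induction close under `Fin.tail`. The sign of
the distributional derivative cancels the one in `integral_lineDeriv_faceMeasure`. -/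
theorem iteratedLineDeriv_choquetExt_apply {k : ℕ} (v : (N → Fin (k + 1)) → ℝ) {n : ℕ}
    (e : Fin n → N) (he : Function.Injective e) (g : 𝓓(openBox N k, ℝ)) :
    (∂^{fun j => (Pi.single (e j) (1 : ℝ) : N → ℝ)}
        (toDistribution (openBox N k) (choquetExt v)) : 𝓓'(openBox N k, ℝ)) g =
      ∑ x, v x * ∑ B : Finset N, (-1 : ℝ) ^ B.card *
        ∫ z, g z ∂(faceMeasure k (Finset.univ.image e) (offset x B)) := by
  induction n generalizing g with
  | zero =>
    rw [LineDeriv.iteratedLineDerivOp_fin_zero, toDistribution_choquetExt_eq_sum]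
    simp
  | succ n ih =>
    rw [LineDeriv.iteratedLineDerivOp_succ_left, Distribution.lineDerivOp_apply_apply, map_neg]
    have htail := ih (Fin.tail e) (he.comp (Fin.succ_injective n))
      (∂_{(Pi.single (e 0) 1 : N → ℝ)} g)
    have hnot : e 0 ∉ Finset.univ.image (Fin.tail e) := by
      simp only [Finset.mem_image, Finset.mem_univ, true_and, Fin.tail, not_exists]
      exact fun j hj => Fin.succ_ne_zero j (he hj)
    have himage : Finset.univ.image e = insert (e 0) (Finset.univ.image (Fin.tail e)) := by
      ext i
      simp [Fin.exists_fin_succ, Fin.tail, eq_comm]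
    simp_rw [integral_lineDeriv_faceMeasure g hnot, ← himage] at htail
    refine (congrArg Neg.neg htail).trans ?_
    simp [Finset.mul_sum]

theorem mixedPartial_choquetExt_apply {k : ℕ} (v : (N → Fin (k + 1)) → ℝ) (T : Finset N)
    (g : 𝓓(openBox N k, ℝ)) :
    mixedPartial T (toDistribution (openBox N k) (choquetExt v)) g =
      ∑ x, v x * ∑ B : Finset N, (-1 : ℝ) ^ B.card *
        ∫ z, g z ∂(faceMeasure k T (offset x B)) := by
  have himage : Finset.univ.image (fun j : Fin T.card => (T.equivFin.symm j : N)) = T := by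
    ext i
    simp only [Finset.mem_image, Finset.mem_univ, true_and]
    exact ⟨by rintro ⟨j, rfl⟩; exact (T.equivFin.symm j).2,
      fun hi => ⟨T.equivFin ⟨i, hi⟩, by simp⟩⟩
  have := iteratedLineDeriv_choquetExt_apply v (fun j : Fin T.card => (T.equivFin.symm j : N))
    (Subtype.val_injective.comp T.equivFin.symm.injective) g
  rwa [himage] at this

theorem isFiniteMeasure_variation (D : SignedMeasure (N → ℝ)) : IsFiniteMeasure D.variation := by
  rw [← SignedMeasure.totalVariation_eq_variation, SignedMeasure.totalVariation]
  infer_instance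

theorem exists_isRepresentedBy {k : ℕ} (v : (N → Fin (k + 1)) → ℝ) (T : Finset N) :
    ∃ D : SignedMeasure (N → ℝ),
      IsRepresentedBy (mixedPartial T (toDistribution (openBox N k) (choquetExt v))) D := by
  refine ⟨∑ p : (N → Fin (k + 1)) × Finset N, (v p.1 * (-1 : ℝ) ^ p.2.card) •
    (faceMeasure k T (offset p.1 p.2)).toSignedMeasure, fun g => ?_⟩
  rw [mixedPartial_choquetExt_apply, VectorMeasure.integral_finsetSum_vectorMeasure]
  · simp_rw [VectorMeasure.integral_smul_vectorMeasure, VectorMeasure.integral_toSignedMeasure]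
    rw [Fintype.sum_prod_type]
    simp [Finset.mul_sum, mul_assoc]
  · intro p _
    have := isFiniteMeasure_variation ((v p.1 * (-1 : ℝ) ^ p.2.card) •
      (faceMeasure k T (offset p.1 p.2)).toSignedMeasure)
    exact integrable_testFunction g _

theorem exists_cutoff (k : ℕ) :
    ∃ g : ℕ → 𝓓(openBox N k, ℝ), (∀ n z, ‖g n z‖ ≤ 1) ∧
      ∀ z, Filter.Tendsto (fun n => g n z) Filter.atTop
        (nhds ((openBox N k : Set (N → ℝ)).indicator 1 z)) := by
  obtain ⟨f, hsupp, hf, hrange⟩ := (openBox N k).isOpen.exists_contDiff_support_eq (n := ⊤)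
  have hf0 : ∀ z, 0 ≤ f z := fun z => (hrange (Set.mem_range_self z)).1
  -- `f` is positive exactly on the box. The shift by `1` keeps the closed support inside `{n f ≥
  -- 1}`, hence inside the open box, and the value is `1` once `n f z ≥ 2`.
  set F : ℕ → (N → ℝ) → ℝ := fun n z => Real.smoothTransition (n * f z - 1) with hF
  have hclosed : ∀ n : ℕ, IsClosed {z | 1 ≤ n * f z} := fun n =>
    isClosed_le continuous_const (continuous_const.mul hf.continuous)
  have htsupp : ∀ n, tsupport (F n) ⊆ {z | 1 ≤ n * f z} := fun n =>
    closure_minimal (fun z hz => by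
      by_contra h
      exact hz (Real.smoothTransition.zero_of_nonpos (by
        simp only [Set.mem_ofPred_eq, not_le] at h; linarith))) (hclosed n)
  have hsub : ∀ n : ℕ, {z | 1 ≤ n * f z} ⊆ (openBox N k : Set (N → ℝ)) := by
    intro n z hz
    rw [← hsupp]
    intro h0
    simp only [Set.mem_ofPred_eq, h0, mul_zero] at hz
    linarith
  have hsubc : (openBox N k : Set (N → ℝ)) ⊆ closedBox N k :=
    Set.pi_mono fun _ _ => Set.Ioo_subset_Icc_self
  refine ⟨fun n => ⟨F n, ?_, ?_, (htsupp n).trans (hsub n)⟩, fun n z => ?_, fun z => ?_⟩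
  · exact Real.smoothTransition.contDiff.comp ((contDiff_const.mul hf).sub contDiff_const)
  · refine IsCompact.of_isClosed_subset ?_ (isClosed_tsupport _)
      (((htsupp n).trans (hsub n)).trans hsubc)
    rw [closedBox_eq_Icc]
    exact isCompact_Icc
  · change ‖F n z‖ ≤ 1
    rw [Real.norm_of_nonneg (Real.smoothTransition.nonneg _)]
    exact Real.smoothTransition.le_one _
  · change Filter.Tendsto (fun n => F n z) _ _
    by_cases hz : z ∈ (openBox N k : Set (N → ℝ))
    · rw [Set.indicator_of_mem hz]
      rw [← hsupp] at hz
      have hpos : 0 < f z := lt_of_le_of_ne (hf0 z) (Ne.symm hz)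
      refine tendsto_const_nhds.congr' ?_
      filter_upwards [Filter.eventually_ge_atTop ⌈2 / f z⌉₊] with n hn
      have : 2 / f z ≤ n := Nat.ceil_le.1 hn
      rw [div_le_iff₀ hpos] at this
      exact (Real.smoothTransition.one_of_one_le (by linarith)).symm
    · rw [Set.indicator_of_notMem hz]
      rw [← hsupp, Function.notMem_support] at hz
      refine tendsto_const_nhds.congr fun n => ?_
      exact (Real.smoothTransition.zero_of_nonpos (by simp [hz])).symm

theorem tendsto_integral_cutoff {k : ℕ} {g : ℕ → 𝓓(openBox N k, ℝ)}
    (hg : ∀ n z, ‖g n z‖ ≤ 1)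
    (hlim : ∀ z, Filter.Tendsto (fun n => g n z) Filter.atTop
      (nhds ((openBox N k : Set (N → ℝ)).indicator 1 z))) (μ : Measure (N → ℝ))
    [IsFiniteMeasure μ] :
    Filter.Tendsto (fun n => ∫ z, g n z ∂μ) Filter.atTop
      (nhds (μ.real (openBox N k : Set (N → ℝ)))) := by
  rw [← integral_indicator_one (measurableSet_openBox k)]
  exact tendsto_integral_of_dominated_convergence (fun _ => 1)
    (fun n => (g n).continuous.aestronglyMeasurable) (integrable_const _)
    (fun n => .of_forall (hg n)) (.of_forall hlim)

theorem tendsto_mixedPartial_cutoff {k : ℕ} (hk : k ≠ 0) (v : (N → Fin (k + 1)) → ℝ)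
    (T : Finset N) {g : ℕ → 𝓓(openBox N k, ℝ)}
    (hg : ∀ n z, ‖g n z‖ ≤ 1)
    (hlim : ∀ z, Filter.Tendsto (fun n => g n z) Filter.atTop
      (nhds ((openBox N k : Set (N → ℝ)).indicator 1 z))) :
    Filter.Tendsto
      (fun n => mixedPartial T (toDistribution (openBox N k) (choquetExt v)) (g n))
      Filter.atTop (nhds (interaction v T)) := by
  simp_rw [mixedPartial_choquetExt_apply, ← sum_faceMeasure_openBox hk]
  exact tendsto_finsetSum _ fun x _ => Filter.Tendsto.const_mul _ <|
    tendsto_finsetSum _ fun B _ => Filter.Tendsto.const_mul _ <|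
      tendsto_integral_cutoff hg hlim _

/-- Test functions do not see mass of `D` outside the box, so only this value is determined. It is
the limit along the cutoffs, by dominated convergence for `D`. -/
theorem apply_openBox_of_isRepresentedBy {k : ℕ} (hk : k ≠ 0) (v : (N → Fin (k + 1)) → ℝ)
    (T : Finset N) {D : SignedMeasure (N → ℝ)}
    (hD : IsRepresentedBy (mixedPartial T (toDistribution (openBox N k) (choquetExt v))) D) :
    D (openBox N k : Set (N → ℝ)) = interaction v T := by
  obtain ⟨g, hg, hlim⟩ := exists_cutoff (N := N) k
  have := isFiniteMeasure_variation D
  refine tendsto_nhds_unique ?_ (tendsto_mixedPartial_cutoff hk v T hg hlim)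
  refine Filter.Tendsto.congr (fun n => (hD (g n)).symm) ?_
  have h : Filter.Tendsto (fun n => ∫ᵛ z, g n z ∂<•D) Filter.atTop
      (nhds (∫ᵛ z, (openBox N k : Set (N → ℝ)).indicator (fun _ => (1 : ℝ)) z ∂<•D)) :=
    VectorMeasure.tendsto_integral_of_dominated_convergence (fun _ => 1)
    (fun n => (g n).continuous.aestronglyMeasurable) (integrable_const _)
    (fun n => .of_forall (hg n)) (.of_forall hlim)
  rw [VectorMeasure.integral_indicator_const (1 : ℝ) (measurableSet_openBox k)] at h
  simpa using h

end Representation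

/-! ### The pointwise partial derivative -/

section PartialDerivative

variable {N : Type*} [Fintype N] [DecidableEq N]

/-- Integration by parts for a Lipschitz function against a compactly supported one. It uses that
`choquetLipschitz v` is Lipschitz on the whole space, not merely on the box. -/
theorem mixedPartial_singleton_apply {k : ℕ} (v : (N → Fin (k + 1)) → ℝ) (i : N)
    (g : 𝓓(openBox N k, ℝ)) :
    mixedPartial {i} (toDistribution (openBox N k) (choquetExt v)) g =
      ∫ z in (openBox N k : Set (N → ℝ)),
        lineDeriv ℝ (choquetLipschitz v) z (Pi.single i 1) * g z := by
  obtain ⟨C, hC⟩ := exists_lipschitzWith_choquetLipschitz v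
  obtain ⟨C', hC'⟩ := (g.contDiff.of_le
    (by simp : (1 : WithTop ℕ∞) ≤ _)).lipschitzWith_of_hasCompactSupport
      g.hasCompactSupport one_ne_zero
  have h1 : mixedPartial {i} (toDistribution (openBox N k) (choquetExt v)) g =
      - toDistribution (openBox N k) (choquetExt v) (∂_{(Pi.single i 1 : N → ℝ)} g) := by
    rw [mixedPartial_choquetExt_apply, toDistribution_choquetExt_eq_sum]
    simp_rw [integral_lineDeriv_faceMeasure g (Finset.notMem_empty i)]
    simp [Finset.mul_sum]
  have h0 : ∀ (h : 𝓓(openBox N k, ℝ)) (f : (N → ℝ) → ℝ),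
      ∫ z in (openBox N k : Set (N → ℝ)), h z * f z = ∫ z, h z * f z := fun h f =>
    setIntegral_eq_integral_of_forall_compl_eq_zero fun z hz => by
      rw [eq_zero_of_notMem_openBox h hz, zero_mul]
  simp_rw [mul_comm _ (g _)]
  rw [h1, toDistribution_choquetExt_apply, h0, h0, ← integral_neg]
  simp_rw [mul_comm (g _)]
  rw [hC.integral_lineDeriv_mul_eq hC' g.hasCompactSupport]
  congr 1
  funext z
  rw [lineDerivOp_apply_eq, lineDeriv_neg, neg_mul]

theorem update_eq_add_smul_single (z : N → ℝ) (i : N) (s : ℝ) :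
    Function.update z i s = z + (s - z i) • (Pi.single i 1 : N → ℝ) := by
  funext j
  by_cases h : j = i
  · subst h; simp
  · simp [h]

theorem eventuallyEq_choquetExt_update {k : ℕ} (v : (N → Fin (k + 1)) → ℝ) (i : N) {z : N → ℝ}
    (hz : z ∈ openBox N k) :
    (fun s => choquetExt v (Function.update z i s)) =ᶠ[nhds (z i)]
      fun s => choquetLipschitz v (z + (s - z i) • (Pi.single i 1 : N → ℝ)) := by
  have hc : Filter.Tendsto (fun s => Function.update z i s) (nhds (z i)) (nhds z) := by
    have : Continuous fun s : ℝ => Function.update z i s := continuous_const.update i continuous_id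
    simpa using this.tendsto (z i)
  filter_upwards [hc ((openBox N k).isOpen.mem_nhds hz)] with s hs
  rw [← update_eq_add_smul_single]
  exact choquetExt_eq v hs

theorem partialDeriv_choquetExt {k : ℕ} (v : (N → Fin (k + 1)) → ℝ) (i : N) {z : N → ℝ}
    (hz : z ∈ openBox N k) :
    partialDeriv i (choquetExt v) z = lineDeriv ℝ (choquetLipschitz v) z (Pi.single i 1) := by
  rw [partialDeriv, (eventuallyEq_choquetExt_update v i hz).deriv_eq, lineDeriv]
  rw [deriv_comp_sub_const (f := fun t : ℝ =>
    choquetLipschitz v (z + t • (Pi.single i 1 : N → ℝ))), sub_self]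

theorem differentiableAt_choquetExt_update {k : ℕ} (v : (N → Fin (k + 1)) → ℝ) (i : N) {z : N → ℝ}
    (hz : z ∈ openBox N k)
    (h : LineDifferentiableAt ℝ (choquetLipschitz v) z (Pi.single i 1)) :
    DifferentiableAt ℝ (fun s => choquetExt v (Function.update z i s)) (z i) := by
  rw [(eventuallyEq_choquetExt_update v i hz).differentiableAt_iff]
  have h' : DifferentiableAt ℝ (fun t : ℝ =>
      choquetLipschitz v (z + t • (Pi.single i 1 : N → ℝ))) (z i - z i) := by
    rw [sub_self]; exact h
  have hs : DifferentiableAt ℝ (fun s : ℝ => s - z i) (z i) := by fun_prop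
  exact DifferentiableAt.comp (g := fun t : ℝ =>
    choquetLipschitz v (z + t • (Pi.single i 1 : N → ℝ))) (z i) h' hs

end PartialDerivative

end KAry

end

theorem mainTheorem2 {N : Type*} [Fintype N] [DecidableEq N] (k : ℕ)
    (v : (N → Fin (k + 1)) → ℝ) (hv : KAry.IsCapacity v) (T : Finset N) :
    IntegrableOn (KAry.choquetExt v) (KAry.closedBox N k) ∧
    (∃ D : SignedMeasure (N → ℝ),
      KAry.IsRepresentedBy
        (KAry.mixedPartial T (KAry.toDistribution (KAry.openBox N k) (KAry.choquetExt v))) D) ∧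
    (∀ D : SignedMeasure (N → ℝ),
      KAry.IsRepresentedBy
        (KAry.mixedPartial T (KAry.toDistribution (KAry.openBox N k) (KAry.choquetExt v))) D →
      D (KAry.openBox N k : Set (N → ℝ)) = KAry.interaction v T) ∧
    (∀ i : N, T = {i} →
      (∀ᵐ z ∂(volume.restrict (KAry.closedBox N k)),
        DifferentiableAt ℝ (fun s => KAry.choquetExt v (Function.update z i s)) (z i)) ∧
      IntegrableOn (KAry.partialDeriv i (KAry.choquetExt v)) (KAry.closedBox N k) ∧
      ∫ z in KAry.closedBox N k, KAry.partialDeriv i (KAry.choquetExt v) z =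
        KAry.interaction v T) := by
  -- For `k = 0` the bottom and top of `L` coincide and the normalisations would give `0 = 1`.
  have hk : k ≠ 0 := by
    rintro rfl
    have h := hv.top
    rw [show (fun _ : N => Fin.last 0) = fun _ => 0 from rfl, hv.zero] at h
    exact zero_ne_one h
  refine ⟨KAry.integrableOn_choquetExt v, KAry.exists_isRepresentedBy v T,
    fun D hD => KAry.apply_openBox_of_isRepresentedBy hk v T hD, ?_⟩
  rintro i rfl
  obtain ⟨C, hC⟩ := KAry.exists_lipschitzWith_choquetLipschitz v
  have : IsFiniteMeasure (volume.restrict (KAry.openBox N k : Set (N → ℝ))) :=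
    ⟨by simpa using KAry.volume_openBox_lt_top k⟩
  have hd : IntegrableOn (fun z => lineDeriv ℝ (KAry.choquetLipschitz v) z (Pi.single i 1))
      (KAry.openBox N k : Set (N → ℝ)) :=
    Integrable.of_bound (C := C * ‖(Pi.single i 1 : N → ℝ)‖)
      (aestronglyMeasurable_lineDeriv hC.continuous _)
      (.of_forall fun z => norm_lineDeriv_le_of_lipschitz ℝ hC)
  rw [IntegrableOn, KAry.restrict_closedBox]
  refine ⟨?_, ?_, ?_⟩
  · rw [ae_restrict_iff' (KAry.measurableSet_openBox k)]
    filter_upwards [hC.ae_lineDifferentiableAt (μ := volume) (Pi.single i 1)] with z hz hzb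
    exact KAry.differentiableAt_choquetExt_update v i hzb hz
  · exact (integrableOn_congr_fun (fun z hz => KAry.partialDeriv_choquetExt v i hz)
      (KAry.measurableSet_openBox k)).2 hd
  · rw [setIntegral_congr_fun (KAry.measurableSet_openBox k)
      (fun z hz => KAry.partialDeriv_choquetExt v i hz)]
    -- Both sides are limits of the same sequence: the distribution evaluated at the cutoffs,
    -- computed once by face measures and once by the pointwise derivative.
    obtain ⟨g, hg, hlim⟩ := KAry.exists_cutoff (N := N) k
    refine tendsto_nhds_unique ?_ (KAry.tendsto_mixedPartial_cutoff hk v {i} hg hlim)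
    simp_rw [KAry.mixedPartial_singleton_apply]
    refine tendsto_integral_of_dominated_convergence
      (fun z => ‖lineDeriv ℝ (KAry.choquetLipschitz v) z (Pi.single i 1)‖)
      (fun n => hd.aestronglyMeasurable.mul (g n).continuous.aestronglyMeasurable) hd.norm
      (fun n => .of_forall fun z => ?_) ?_
    · rw [norm_mul]
      exact mul_le_of_le_one_right (norm_nonneg _) (hg n z)
    · rw [ae_restrict_iff' (KAry.measurableSet_openBox k)]
      refine .of_forall fun z hz => ?_
      simpa [Set.indicator_of_mem hz] using (hlim z).const_mul
        (lineDeriv ℝ (KAry.choquetLipschitz v) z (Pi.single i 1))
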